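/- A continuous function $f:\mathbb{R}\to\mathbb{C}$ is called positive definite if $\sum_{j,k=1}^n c_j\overline{c_k}\,f(x_j-x_k)\ge 0$ for all $n$, all $x_1,\dots,x_n\in\mathbb{R}$ and all $c_1,\dots,c_n\in\mathbb{C}$. Let $\Omega^+$ be the cone of continuous even positive definite functions $f$ on $\mathbb{R}$ with $f(x)\ge 0$ for all $x$ (the positive positive definite functions). For $f\in\Omega^+$ let $I(f)=\Omega^+\cap(f-\Omega^+)$, and call $f\in\Omega^+$ an extremal ray generator of $\Omega^+$ if $I(f)=\{t f: 0\le t\le 1\}$. Let $\lambda>0$. (1) Let $P$ be a polynomial of degree $N$ such that $f(x)=P(x)e^{-\lambda\pi x^2}$ belongs to $\Omega^+$. Then $$I(f)\subset\{Q(x)e^{-\lambda\pi x^2} : Q \text{ a polynomial of degree} \le N\}.$$ (2) In particular, the Gaussian $f(x)=e^{-\lambda\pi x^2}$ is an extremal ray generator of $\Omega^+$. -/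

import Mathlib

open scoped ComplexConjugate ComplexOrder

/-- `f` is positive definite: `∑ c_j conj(c_k) f(x_j - x_k)` is a nonnegative real number for all
finite families of points `x_j` and complex coefficients `c_j`. (`0 ≤ z` for `z : ℂ` means that
`z` is real and nonnegative.) -/
def IsPosDefFun {E : Type*} [AddGroup E] (f : E → ℂ) : Prop :=
  ∀ (n : ℕ) (x : Fin n → E) (c : Fin n → ℂ),
    0 ≤ ∑ j, ∑ k, c j * conj (c k) * f (x j - x k)

/-- `f` is radial: its value at `x` depends only on the norm of `x`. On `ℝ` this says that `f` is
even. -/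
def IsRadialFun {E : Type*} [NormedAddCommGroup E] (f : E → ℂ) : Prop :=
  ∀ x y : E, ‖x‖ = ‖y‖ → f x = f y

/-- The cone `Ω` of continuous radial positive definite functions. -/
def OmegaCone (E : Type*) [NormedAddCommGroup E] : Set (E → ℂ) :=
  {f | Continuous f ∧ IsRadialFun f ∧ IsPosDefFun f}

/-- The cone `Ω⁺` of continuous radial positive definite functions that are also (real and)
pointwise nonnegative, i.e. of positive positive definite functions. -/
def OmegaPlus (E : Type*) [NormedAddCommGroup E] : Set (E → ℂ) :=
  {f | f ∈ OmegaCone E ∧ ∀ x, 0 ≤ f x}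

/-- The interval `I(f) = Ω⁺ ∩ (f - Ω⁺)` generated by `f`. -/
def OmegaInterval {E : Type*} [NormedAddCommGroup E] (f : E → ℂ) : Set (E → ℂ) :=
  OmegaPlus E ∩ {g | ∃ h ∈ OmegaPlus E, g = f - h}

/-- `f` is an extremal ray generator of `Ω⁺`: it belongs to `Ω⁺` and
`I(f) = {t f : 0 ≤ t ≤ 1}`. -/
def IsExtremalRayGenerator {E : Type*} [NormedAddCommGroup E] (f : E → ℂ) : Prop :=
  f ∈ OmegaPlus E ∧ OmegaInterval f = {g | ∃ t : ℝ, 0 ≤ t ∧ t ≤ 1 ∧ g = fun x => (t : ℂ) * f x}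

/-- The Hermite function `x ↦ P(x) e^{-lam π x²}` on the real line. -/
noncomputable def hermiteFun (lam : ℝ) (P : Polynomial ℂ) : ℝ → ℂ :=
  fun x => P.eval (x : ℂ) * (Real.exp (-(lam * Real.pi * x ^ 2)) : ℂ)

section

open MeasureTheory Filter Topology ProbabilityTheory FourierTransform

/-! Suppose f = g + h with g, h in Ω⁺. Since h ≥ 0, g ≤ f pointwise; since the Fourier transform of
h is also nonnegative, ĝ ≤ f̂. If f is a polynomial of degree at most N times e^{-λπx²}, then f̂ is
such a polynomial times e^{-πξ²/λ} (`exists_fourier_hermiteFun`). So g and ĝ both decay at the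
critical rate of Hardy's uncertainty principle, up to factors of degree N, and
`exists_eq_hermiteFun_of_norm_le` forces g to be a polynomial of degree at most N times e^{-λπx²}.
For N = 0 this gives g = t f, and positivity at the origin gives 0 ≤ t ≤ 1.

Nonnegativity of the transform (`IsPosDefFun.fourier_nonneg`) comes from testing positive
definiteness against wide Gaussians.

For Hardy's principle, extend ĝ to an entire function G and put H(z) = G(z) e^{πz²/λ}. The decay of
g bounds H by (1 + |Im z|)^N e^{π(Re z)²/λ} up to a constant, and the decay of ĝ bounds it
polynomially on the real axis. Phragmén–Lindelöf gives polynomial growth everywhere, so H is a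
polynomial by Liouville; Fourier inversion returns to g. -/

/-! ### Nonnegativity of the Fourier transform of a positive definite function -/

lemma IsPosDefFun.sum_finset_nonneg {E : Type*} [AddGroup E] {f : E → ℂ} (hf : IsPosDefFun f)
    (s : Finset E) (c : E → ℂ) :
    0 ≤ ∑ a ∈ s, ∑ b ∈ s, c a * conj (c b) * f (a - b) := by
  have h := hf s.card (fun i => (s.equivFin.symm i : E)) (fun i => c (s.equivFin.symm i : E))
  have key : ∀ F : E → ℂ, ∑ i, F (s.equivFin.symm i : E) = ∑ a ∈ s, F a := fun F => by
    rw [Equiv.sum_comp s.equivFin.symm (fun a : s => F a), Finset.sum_coe_sort]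
  rw [key (fun a => ∑ k, c a * conj (c (s.equivFin.symm k)) * f (a - s.equivFin.symm k))] at h
  refine h.trans_eq (Finset.sum_congr rfl fun a _ => ?_)
  exact key (fun b => c a * conj (c b) * f (a - b))

/-- Replacing both variables by simple functions converging to the identity turns the double
integral into the defining quadratic form, with the masses of the fibres as coefficients. Dominated
convergence passes to the limit. -/
lemma IsPosDefFun.integral_integral_sub_nonneg {f : ℝ → ℂ} (hf : IsPosDefFun f)
    (hc : Continuous f) {C : ℝ} (hC : ∀ x, ‖f x‖ ≤ C) (μ : Measure ℝ) [IsFiniteMeasure μ] :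
    0 ≤ ∫ x, ∫ y, f (x - y) ∂μ ∂μ := by
  let s : ℕ → SimpleFunc ℝ ℝ :=
    SimpleFunc.approxOn id measurable_id Set.univ 0 (Set.mem_univ _)
  have hs : ∀ x, Tendsto (fun n => s n x) atTop (𝓝 x) := fun x =>
    SimpleFunc.tendsto_approxOn measurable_id (Set.mem_univ _) (by simp)
  have hsimple : ∀ n (g : ℝ → ℂ),
      ∫ y, g (s n y) ∂μ = ∑ b ∈ (s n).range, μ.real (s n ⁻¹' {b}) • g b := fun n g => by
    have h : ∀ y, g (s n y)
        = ∑ b ∈ (s n).range, (s n ⁻¹' {b}).indicator (fun _ => g b) y := fun y => by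
      rw [Finset.sum_eq_single (s n y) (fun b _ hb => Set.indicator_of_notMem (by
        simpa using hb.symm) _) (fun h => absurd ((s n).mem_range_self y) h)]
      simp
    simp_rw [h]
    rw [integral_finsetSum _ fun b _ =>
      (integrable_const _).indicator ((s n).measurableSet_fiber b)]
    exact Finset.sum_congr rfl fun b _ =>
      integral_indicator_const _ ((s n).measurableSet_fiber b)
  have hinner : ∀ n x, ‖∫ y, f (x - s n y) ∂μ‖ ≤ C * μ.real Set.univ := fun n x =>
    norm_integral_le_of_norm_le_const (ae_of_all _ fun y => hC _)
  have hlim : Tendsto (fun n => ∫ x, ∫ y, f (s n x - s n y) ∂μ ∂μ) atTop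
      (𝓝 (∫ x, ∫ y, f (x - y) ∂μ ∂μ)) := by
    refine tendsto_integral_of_dominated_convergence (fun _ => C * μ.real Set.univ)
      (fun n => ?_) (integrable_const _) (fun n => ae_of_all _ fun x => hinner n _)
      (ae_of_all _ fun x => ?_)
    · exact ((s n).map fun a => ∫ y, f (a - s n y) ∂μ).aestronglyMeasurable
    · refine tendsto_integral_of_dominated_convergence (fun _ => C)
        (fun n => ?_) (integrable_const _) (fun n => ae_of_all _ fun y => hC _)
        (ae_of_all _ fun y => ?_)
      · exact ((s n).map fun b => f (s n x - b)).aestronglyMeasurable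
      · exact (hc.tendsto _).comp ((hs x).sub (hs y))
  refine ge_of_tendsto' hlim fun n => ?_
  rw [hsimple n fun a => ∫ y, f (a - s n y) ∂μ]
  refine (hf.sum_finset_nonneg (s n).range (fun a => (μ.real (s n ⁻¹' {a}) : ℂ))).trans_eq
    (Finset.sum_congr rfl fun a _ => ?_)
  rw [hsimple n fun b => f (a - b), Finset.smul_sum]
  exact Finset.sum_congr rfl fun b _ => by simp [mul_assoc]

/-- A character splits over x_j - x_k and is absorbed into the coefficients. This reduces the
Fourier transform at ξ to an integral, its value at 0. -/
lemma IsPosDefFun.exp_mul {f : ℝ → ℂ} (hf : IsPosDefFun f) (ξ : ℝ) :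
    IsPosDefFun fun x : ℝ => Complex.exp (ξ * x * Complex.I) * f x := by
  intro n x c
  refine (hf n x (fun j => c j * Complex.exp (ξ * x j * Complex.I))).trans_eq
    (Finset.sum_congr rfl fun j _ => Finset.sum_congr rfl fun k _ => ?_)
  have h : Complex.exp (ξ * (x j - x k : ℝ) * Complex.I)
      = Complex.exp (ξ * x j * Complex.I) * conj (Complex.exp (ξ * x k * Complex.I)) := by
    rw [← Complex.exp_conj, ← Complex.exp_add]
    congr 1
    simp only [map_mul, Complex.conj_ofReal, Complex.conj_I, Complex.ofReal_sub]
    ring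
  simp only [h, map_mul]
  ring

/-- The difference of two independent centred Gaussians of variance v has variance 2v, so f has
nonnegative integral against that density. Drop the normalising constant and let v → ∞: the weight
tends to 1. -/
lemma IsPosDefFun.integral_nonneg {f : ℝ → ℂ} (hf : IsPosDefFun f)
    (hc : Continuous f) {C : ℝ} (hC : ∀ x, ‖f x‖ ≤ C) (hi : Integrable f) :
    0 ≤ ∫ x, f x := by
  have hgauss : ∀ v : NNReal, v ≠ 0 → 0 ≤ ∫ x, Real.exp (-x ^ 2 / (2 * (v + v))) • f x := by
    intro v hv
    -- Symmetry of the Gaussian turns f (x - y) into f (x + y), which makes the double integral a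
    -- convolution.
    have hneg : (gaussianReal 0 v).map (fun x => -x) = gaussianReal 0 v := by
      rw [gaussianReal_map_neg, neg_zero]
    have h := hf.integral_integral_sub_nonneg hc hC (gaussianReal 0 v)
    have h1 : ∫ x, ∫ y, f (x - y) ∂(gaussianReal 0 v) ∂(gaussianReal 0 v)
        = ∫ x, f x ∂(gaussianReal 0 (v + v)) := by
      have hb : Integrable f (gaussianReal 0 v ∗ gaussianReal 0 v) :=
        Integrable.of_bound hc.aestronglyMeasurable C (ae_of_all _ hC)
      have h2 := gaussianReal_conv_gaussianReal (m₁ := 0) (m₂ := 0) (v₁ := v) (v₂ := v)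
      rw [add_zero] at h2
      rw [← h2, integral_conv hb]
      refine integral_congr_ae (ae_of_all _ fun x => ?_)
      simp only
      conv_rhs => rw [← hneg]
      rw [integral_map (by fun_prop) (by fun_prop)]
      simp [sub_eq_add_neg]
    rw [h1, integral_gaussianReal_eq_integral_smul (by simpa using hv)] at h
    simp only [gaussianPDFReal, sub_zero, mul_smul] at h
    rw [integral_smul] at h
    have hpos : 0 < (√(2 * Real.pi * ((v + v : NNReal) : ℝ)))⁻¹ := by
      have : 0 < (v : ℝ) := by positivity
      push_cast
      positivity
    have := smul_nonneg (inv_nonneg.2 hpos.le) h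
    rw [smul_smul, inv_mul_cancel₀ hpos.ne', one_smul] at this
    simpa using this
  have hlim : Tendsto (fun n : ℕ => ∫ x, Real.exp (-x ^ 2 / (2 * (((n : NNReal) + 1 : NNReal)
      + ((n : NNReal) + 1 : NNReal)))) • f x) atTop (𝓝 (∫ x, f x)) := by
    refine tendsto_integral_of_dominated_convergence (fun x => ‖f x‖)
      (fun n => by fun_prop) hi.norm (fun n => ae_of_all _ fun x => ?_)
      (ae_of_all _ fun x => ?_)
    · rw [norm_smul]
      refine mul_le_of_le_one_left (norm_nonneg _) ?_
      rw [Real.norm_of_nonneg (Real.exp_pos _).le, Real.exp_le_one_iff, neg_div]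
      have : 0 ≤ x ^ 2 / (2 * ((((n : NNReal) + 1 : NNReal) : ℝ)
        + ((n : NNReal) + 1 : NNReal))) := by positivity
      linarith
    · have h0 : Tendsto (fun n : ℕ => -x ^ 2 / (2 * ((((n : NNReal) + 1 : NNReal) : ℝ)
          + ((n : NNReal) + 1 : NNReal)))) atTop (𝓝 0) := by
        refine Tendsto.div_atTop tendsto_const_nhds ?_
        refine tendsto_atTop_mono (fun n : ℕ => ?_) (tendsto_natCast_atTop_atTop (R := ℝ))
        push_cast
        linarith [(n.cast_nonneg : (0 : ℝ) ≤ n)]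
      have := ((Real.continuous_exp.tendsto 0).comp h0).smul_const (f x)
      simpa using this
  exact ge_of_tendsto' hlim fun n => hgauss _ (by positivity)

lemma IsPosDefFun.fourier_nonneg {f : ℝ → ℂ} (hf : IsPosDefFun f)
    (hc : Continuous f) {C : ℝ} (hC : ∀ x, ‖f x‖ ≤ C) (hi : Integrable f) (ξ : ℝ) :
    0 ≤ 𝓕 f ξ := by
  have hn : ∀ x : ℝ, ‖Complex.exp ((-2 * Real.pi * ξ : ℝ) * x * Complex.I)‖ = 1 := fun x => by
    rw [← Complex.ofReal_mul, Complex.norm_exp_ofReal_mul_I]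
  have h := (hf.exp_mul (-2 * Real.pi * ξ)).integral_nonneg (by fun_prop) (C := C)
    (fun x => by rw [norm_mul, hn, one_mul]; exact hC x)
    (by
      refine hi.bdd_mul (c := 1) (by fun_prop) (ae_of_all _ fun x => (hn x).le))
  rw [Real.fourier_real_eq_integral_exp_smul]
  refine h.trans_eq (integral_congr_ae (ae_of_all _ fun x => ?_))
  simp only [smul_eq_mul]
  congr 3
  push_cast
  ring

/-! ### Hermite functions and their Fourier transforms -/

lemma Polynomial.exists_norm_eval_ofReal_le {N : ℕ} {P : Polynomial ℂ} (hP : P.natDegree ≤ N) :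
    ∃ C : ℝ, 0 ≤ C ∧ ∀ x : ℝ, ‖P.eval (x : ℂ)‖ ≤ C * (1 + |x|) ^ N := by
  refine ⟨∑ i ∈ Finset.range (N + 1), ‖P.coeff i‖, by positivity, fun x => ?_⟩
  rw [Polynomial.eval_eq_sum_range' (Nat.lt_succ_of_le hP), Finset.sum_mul]
  refine norm_sum_le_of_le _ fun i hi => ?_
  rw [norm_mul, norm_pow, Complex.norm_real, Real.norm_eq_abs]
  gcongr
  calc |x| ^ i ≤ (1 + |x|) ^ i := by gcongr; linarith
    _ ≤ (1 + |x|) ^ N := pow_le_pow_right₀ (by linarith [abs_nonneg x])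
        (Nat.lt_succ_iff.1 (Finset.mem_range.1 hi))

lemma integrable_one_add_abs_pow_mul_exp_neg_mul_sq (N : ℕ) {b : ℝ} (hb : 0 < b) :
    Integrable fun x : ℝ => (1 + |x|) ^ N * Real.exp (-(b * x ^ 2)) := by
  have h1 : Integrable fun x : ℝ => Real.exp (-(b * x ^ 2)) := by
    simpa using integrable_exp_neg_mul_sq hb
  have h2 : Integrable fun x : ℝ => x ^ N * Real.exp (-(b * x ^ 2)) := by
    simpa using integrable_rpow_mul_exp_neg_mul_sq hb (s := N)
      (by linarith [(N.cast_nonneg : (0 : ℝ) ≤ N)])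
  refine ((h1.add h2.norm).const_mul (2 ^ (N - 1))).mono' (by fun_prop) (ae_of_all _ fun x => ?_)
  rw [Real.norm_of_nonneg (by positivity)]
  have := add_pow_le zero_le_one (abs_nonneg x) N
  calc (1 + |x|) ^ N * Real.exp (-(b * x ^ 2))
      ≤ (2 ^ (N - 1) * (1 ^ N + |x| ^ N)) * Real.exp (-(b * x ^ 2)) := by gcongr
    _ = _ := by
      simp only [Pi.add_apply, norm_mul, norm_pow, Real.norm_eq_abs, Real.abs_exp]
      ring

lemma continuous_hermiteFun (lam : ℝ) (P : Polynomial ℂ) : Continuous (hermiteFun lam P) := by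
  unfold hermiteFun
  fun_prop

lemma exists_norm_hermiteFun_le (lam : ℝ) {N : ℕ} {P : Polynomial ℂ} (hP : P.natDegree ≤ N) :
    ∃ C : ℝ, 0 ≤ C ∧ ∀ x : ℝ, ‖hermiteFun lam P x‖
      ≤ C * ((1 + |x|) ^ N * Real.exp (-(lam * Real.pi * x ^ 2))) := by
  obtain ⟨C, hC, h⟩ := Polynomial.exists_norm_eval_ofReal_le hP
  refine ⟨C, hC, fun x => ?_⟩
  rw [hermiteFun, norm_mul, Complex.norm_real, Real.norm_of_nonneg (Real.exp_pos _).le,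
    ← mul_assoc]
  gcongr
  exact h x

lemma integrable_hermiteFun {lam : ℝ} (hlam : 0 < lam) (P : Polynomial ℂ) :
    Integrable (hermiteFun lam P) := by
  obtain ⟨C, -, h⟩ := exists_norm_hermiteFun_le lam (le_refl P.natDegree)
  exact ((integrable_one_add_abs_pow_mul_exp_neg_mul_sq _ (mul_pos hlam Real.pi_pos)).const_mul
    C).mono' (continuous_hermiteFun lam P).aestronglyMeasurable (ae_of_all _ h)

lemma hermiteFun_X_mul (lam : ℝ) (P : Polynomial ℂ) (x : ℝ) :
    hermiteFun lam (Polynomial.X * P) x = x * hermiteFun lam P x := by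
  simp [hermiteFun, mul_assoc]

lemma hasDerivAt_hermiteFun (lam : ℝ) (P : Polynomial ℂ) (x : ℝ) :
    HasDerivAt (hermiteFun lam P) (hermiteFun lam (Polynomial.derivative P
      - Polynomial.C (2 * lam * Real.pi : ℂ) * (Polynomial.X * P)) x) x := by
  have h1 : HasDerivAt (fun x : ℝ => P.eval (x : ℂ)) ((Polynomial.derivative P).eval (x : ℂ)) x :=
    (P.hasDerivAt (x : ℂ)).comp_ofReal
  have h2 : HasDerivAt (fun x : ℝ => Real.exp (-(lam * Real.pi * x ^ 2)))
      (Real.exp (-(lam * Real.pi * x ^ 2)) * (-(lam * Real.pi * (2 * x)))) x := by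
    have := ((hasDerivAt_pow 2 x).const_mul (lam * Real.pi)).neg.exp
    simpa using this
  refine (h1.mul h2.ofReal_comp).congr_deriv ?_
  simp [hermiteFun]
  ring

lemma fourier_hermiteFun_add {lam : ℝ} (hlam : 0 < lam) (P Q : Polynomial ℂ) :
    𝓕 (hermiteFun lam (P + Q)) = 𝓕 (hermiteFun lam P) + 𝓕 (hermiteFun lam Q) := by
  have h : hermiteFun lam (P + Q) = hermiteFun lam P + hermiteFun lam Q := by
    ext x
    simp [hermiteFun, add_mul]
  rw [h]
  exact (VectorFourier.fourierIntegral_add Real.continuous_fourierChar (by fun_prop)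
    (integrable_hermiteFun hlam P) (integrable_hermiteFun hlam Q))

lemma fourier_hermiteFun_C_mul (lam : ℝ) (a : ℂ) (P : Polynomial ℂ) :
    𝓕 (hermiteFun lam (Polynomial.C a * P)) = a • 𝓕 (hermiteFun lam P) := by
  have h : hermiteFun lam (Polynomial.C a * P) = a • hermiteFun lam P := by
    ext x
    simp [hermiteFun, mul_assoc]
  rw [h]
  exact VectorFourier.fourierIntegral_const_smul _ _ _ _ _

lemma exists_fourier_hermiteFun_one {lam : ℝ} (hlam : 0 < lam) :
    ∃ a : ℂ, 𝓕 (hermiteFun lam 1) = hermiteFun lam⁻¹ (Polynomial.C a) := by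
  refine ⟨1 / (lam : ℂ) ^ (1 / 2 : ℂ), ?_⟩
  have h := fourier_gaussian_pi (b := (lam : ℂ)) (by simpa using hlam)
  have h1 : hermiteFun lam 1 = fun x : ℝ => Complex.exp (-Real.pi * lam * x ^ 2) := by
    ext x
    simp only [hermiteFun, Polynomial.eval_one, one_mul]
    push_cast
    ring_nf
  rw [h1, h]
  ext x
  simp only [hermiteFun, Polynomial.eval_C]
  push_cast
  ring_nf

/-- Induction through P = X * `P.divX` + constant: multiplication by x becomes differentiation
divided by -2πi, which raises the degree of the polynomial factor by at most one. -/
lemma exists_fourier_hermiteFun {lam : ℝ} (hlam : 0 < lam) {N : ℕ} {P : Polynomial ℂ}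
    (hP : P.natDegree ≤ N) :
    ∃ Q : Polynomial ℂ, Q.natDegree ≤ N ∧ 𝓕 (hermiteFun lam P) = hermiteFun lam⁻¹ Q := by
  obtain ⟨a, ha⟩ := exists_fourier_hermiteFun_one hlam
  have hconst : ∀ c : ℂ, 𝓕 (hermiteFun lam (Polynomial.C c))
      = hermiteFun lam⁻¹ (Polynomial.C (c * a)) := fun c => by
    rw [← mul_one (Polynomial.C c), fourier_hermiteFun_C_mul, ha]
    ext x
    simp [hermiteFun, mul_assoc]
  induction N generalizing P with
  | zero =>
    rw [Polynomial.eq_C_of_natDegree_le_zero hP]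
    exact ⟨_, (Polynomial.natDegree_C _).le, hconst _⟩
  | succ N ih =>
    obtain ⟨Q, hQ, hQF⟩ := ih (P := P.divX) (by
      rw [Polynomial.natDegree_divX_eq_natDegree_tsub_one]; omega)
    have hX : 𝓕 (hermiteFun lam (Polynomial.X * P.divX)) = hermiteFun lam⁻¹
        (Polynomial.C (-2 * Real.pi * Complex.I : ℂ)⁻¹ * (Polynomial.derivative Q
          - Polynomial.C (2 * lam⁻¹ * Real.pi : ℂ) * (Polynomial.X * Q))) := by
      ext w
      have hmul : (fun x : ℝ => x • hermiteFun lam P.divX x)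
          = hermiteFun lam (Polynomial.X * P.divX) := by
        ext x
        rw [hermiteFun_X_mul, Complex.real_smul]
      have h1 := Real.hasDerivAt_fourier (integrable_hermiteFun hlam P.divX)
        (by rw [hmul]; exact integrable_hermiteFun hlam _) w
      have hmul2 : (fun x : ℝ => (-2 * Real.pi * Complex.I * x) • hermiteFun lam P.divX x)
          = hermiteFun lam
            (Polynomial.C (-2 * Real.pi * Complex.I : ℂ) * (Polynomial.X * P.divX)) := by
        ext x
        simp [hermiteFun]
        ring
      rw [hmul2, fourier_hermiteFun_C_mul, hQF] at h1
      have h2 := h1.unique (hasDerivAt_hermiteFun lam⁻¹ Q w)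
      have hne : (-2 * Real.pi * Complex.I : ℂ) ≠ 0 := by
        simp [Real.pi_ne_zero]
      rw [Pi.smul_apply, smul_eq_mul] at h2
      apply mul_left_cancel₀ hne
      rw [h2]
      simp only [hermiteFun, Polynomial.eval_mul, Polynomial.eval_C]
      field_simp
    refine ⟨Polynomial.C (-2 * Real.pi * Complex.I : ℂ)⁻¹ * (Polynomial.derivative Q
          - Polynomial.C (2 * lam⁻¹ * Real.pi : ℂ) * (Polynomial.X * Q))
          + Polynomial.C (P.coeff 0 * a), ?_, ?_⟩
    · refine Polynomial.natDegree_add_le_of_degree_le ?_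
        ((Polynomial.natDegree_C _).trans_le (Nat.zero_le _))
      refine (Polynomial.natDegree_C_mul_le _ _).trans ?_
      refine (Polynomial.natDegree_sub_le _ _).trans (max_le ?_ ?_)
      · exact (Polynomial.natDegree_derivative_le Q).trans (by omega)
      · refine (Polynomial.natDegree_C_mul_le _ _).trans ?_
        refine Polynomial.natDegree_mul_le.trans ?_
        have := Polynomial.natDegree_X_le (R := ℂ)
        omega
    · conv_lhs => rw [← Polynomial.X_mul_divX_add P]
      rw [fourier_hermiteFun_add hlam, hX, hconst]
      ext x
      simp [hermiteFun, add_mul]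

/-! ### Liouville and Phragmén–Lindelöf theorems -/

/-- Cauchy's estimate on circles of radius R → ∞ makes every Taylor coefficient of index above N
vanish. -/
lemma Differentiable.exists_polynomial_of_norm_le {f : ℂ → ℂ} (hf : Differentiable ℂ f)
    {C : ℝ} {N : ℕ} (hC : ∀ z, ‖f z‖ ≤ C * (1 + ‖z‖) ^ N) :
    ∃ P : Polynomial ℂ, P.natDegree ≤ N ∧ ∀ z, f z = P.eval z := by
  have hC0 : 0 ≤ C := by simpa using (norm_nonneg _).trans (hC 0)
  have hzero : ∀ n, N < n → iteratedDeriv n f 0 = 0 := by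
    intro n hn
    have hbound : ∀ R : ℝ, 1 ≤ R → ‖iteratedDeriv n f 0‖ ≤ n.factorial * C * 2 ^ N / R := by
      intro R hR
      have hR0 : 0 < R := by linarith
      have h := Complex.norm_iteratedDeriv_le_of_forall_mem_sphere_norm_le (c := 0)
        (C := C * (2 * R) ^ N) n hR0 hf.diffContOnCl fun z hz => by
          have hz' : ‖z‖ = R := by simpa using hz
          refine (hC z).trans ?_
          rw [hz']
          gcongr
          linarith
      refine h.trans ?_
      rw [div_le_div_iff₀ (by positivity) hR0]
      have : R ^ N * R ≤ R ^ n := by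
        rw [← pow_succ]
        exact pow_le_pow_right₀ hR hn
      calc n.factorial * (C * (2 * R) ^ N) * R = n.factorial * C * 2 ^ N * (R ^ N * R) := by ring
        _ ≤ _ := by gcongr
    have hlim : Tendsto (fun R : ℝ => n.factorial * C * 2 ^ N / R) atTop (𝓝 0) :=
      tendsto_const_nhds.div_atTop tendsto_id
    exact norm_le_zero_iff.1 (ge_of_tendsto hlim ((eventually_ge_atTop 1).mono hbound))
  refine ⟨∑ n ∈ Finset.range (N + 1),
    Polynomial.monomial n ((n.factorial : ℂ)⁻¹ * iteratedDeriv n f 0), ?_, fun z => ?_⟩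
  · refine Polynomial.natDegree_sum_le_of_forall_le _ _ fun i hi => ?_
    exact (Polynomial.natDegree_monomial_le _).trans (Nat.lt_succ_iff.1 (Finset.mem_range.1 hi))
  · rw [← Complex.taylorSeries_eq_of_entire' 0 z hf, tsum_eq_sum (s := Finset.range (N + 1))]
    · simp [Polynomial.eval_finsetSum]
    · intro n hn
      rw [hzero n (by simpa using hn)]
      simp

/-- The Phragmén–Lindelöf principle in a sector of opening `θ < π / 2` for functions of order two. -/
lemma PhragmenLindelof.norm_le_of_sector {f : ℂ → ℂ} {A B C θ : ℝ} (hθ : θ < Real.pi / 2)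
    (hθ0 : 0 < θ)
    (hf : ∀ z : ℂ, 0 ≤ z.re → 0 ≤ z.im → DifferentiableAt ℂ f z)
    (hgrow : ∀ z : ℂ, 0 ≤ z.re → 0 ≤ z.im → ‖f z‖ ≤ A * Real.exp (B * ‖z‖ ^ 2))
    (h0 : ∀ r : ℝ, 0 < r → ‖f r‖ ≤ C)
    (h1 : ∀ r : ℝ, 0 < r → ‖f (r * Complex.exp (θ * Complex.I))‖ ≤ C)
    {z : ℂ} (hz : z ≠ 0) (hz0 : 0 ≤ z.arg) (hzθ : z.arg ≤ θ) : ‖f z‖ ≤ C := by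
  have hquad : ∀ w : ℂ, w.im ∈ Set.Icc 0 θ → 0 ≤ (Complex.exp w).re ∧ 0 ≤ (Complex.exp w).im := by
    intro w hw
    rw [Complex.exp_re, Complex.exp_im]
    exact ⟨mul_nonneg (Real.exp_pos _).le (Real.cos_nonneg_of_mem_Icc
        ⟨by linarith [hw.1, Real.pi_pos], by linarith [hw.2]⟩),
      mul_nonneg (Real.exp_pos _).le (Real.sin_nonneg_of_mem_Icc
        ⟨hw.1, by linarith [hw.2, Real.pi_pos]⟩)⟩
  have hdiff : ∀ w : ℂ, w.im ∈ Set.Icc 0 θ →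
      DifferentiableAt ℂ (fun w => f (Complex.exp w)) w := fun w hw =>
    (hf _ (hquad w hw).1 (hquad w hw).2).comp w Complex.differentiableAt_exp
  -- The exponential maps the strip 0 ≤ Im w ≤ θ onto the sector without its vertex. Order two
  -- becomes growth exp(B e^{2 Re w}), admissible because 2 < π / θ.
  have key := PhragmenLindelof.horizontal_strip (f := fun w => f (Complex.exp w)) (a := 0) (b := θ)
    (C := C) (z := Complex.log z) ?_ ?_ ?_ ?_ (by rwa [Complex.log_im]) (by rwa [Complex.log_im])
  · simpa [Complex.exp_log hz] using key
  · constructor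
    · exact fun w hw => (hdiff w ⟨hw.1.le, hw.2.le⟩).differentiableWithinAt
    · refine fun w hw => (hdiff w ?_).continuousAt.continuousWithinAt
      have := Complex.continuous_im.closure_preimage_subset _ hw
      rwa [closure_Ioo hθ0.ne] at this
  · refine ⟨2, ?_, |B|, ?_⟩
    · rw [sub_zero, lt_div_iff₀ hθ0]
      linarith
    · refine Asymptotics.IsBigO.of_bound |A| ?_
      filter_upwards [mem_inf_of_right (mem_principal_self _)] with w hw
      have hw' := hquad w ⟨hw.1.le, hw.2.le⟩
      refine (hgrow _ hw'.1 hw'.2).trans ?_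
      rw [Complex.norm_exp, Real.norm_of_nonneg (Real.exp_pos _).le, ← Real.exp_nat_mul,
        Nat.cast_ofNat]
      gcongr
      · exact le_abs_self A
      · exact le_abs_self B
      · exact le_abs_self _
  · intro w hw
    have : Complex.exp w = (Real.exp w.re : ℝ) := by
      rw [Complex.ofReal_exp]
      congr 1
      apply Complex.ext <;> simp [hw]
    simp only [this]
    exact h0 _ (Real.exp_pos _)
  · intro w hw
    have : Complex.exp w = (Real.exp w.re : ℝ) * Complex.exp (θ * Complex.I) := by
      rw [Complex.ofReal_exp, ← Complex.exp_add]
      congr 1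
      apply Complex.ext <;> simp [hw]
    simp only [this]
    exact h1 _ (Real.exp_pos _)

lemma norm_cexp_I_mul_sq (δ : ℝ) (z : ℂ) :
    ‖Complex.exp (Complex.I * δ * z ^ 2)‖ = Real.exp (-(2 * δ * z.re * z.im)) := by
  rw [Complex.norm_exp]
  congr 1
  simp [sq]
  ring

lemma norm_cexp_mul_sq (a : ℝ) (z : ℂ) :
    ‖Complex.exp (a * z ^ 2)‖ = Real.exp (a * (z.re ^ 2 - z.im ^ 2)) := by
  rw [Complex.norm_exp]
  congr 1
  simp [sq]

/-- A Phragmén–Lindelöf principle in the first quadrant for functions of order two which grow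
like a polynomial along both axes. -/
lemma norm_le_of_first_quadrant {H : ℂ → ℂ} (hH : Differentiable ℂ H) {a C : ℝ} {N : ℕ}
    (ha : 0 ≤ a)
    (hgrow : ∀ z, ‖H z‖ ≤ C * (1 + |z.im|) ^ N * Real.exp (a * z.re ^ 2))
    (hre : ∀ x : ℝ, ‖H x‖ ≤ C * (1 + |x|) ^ N) {z : ℂ} (hz0 : 0 ≤ z.re) (hz1 : 0 ≤ z.im) :
    ‖H z‖ ≤ C * 4 ^ N * (1 + ‖z‖) ^ N := by
  have hC : 0 ≤ C := by simpa using (norm_nonneg _).trans (hre 0)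
  -- Dividing by (w + 1 + i)^N will remove the polynomial growth; this denominator has no zero in
  -- the closed quadrant.
  have hlow : ∀ w : ℂ, 0 ≤ w.re → 0 ≤ w.im → 1 + ‖w‖ ≤ 2 * ‖w + (1 + Complex.I)‖ := by
    intro w h0 h1
    have h2 : 1 ≤ ‖w + (1 + Complex.I)‖ := by
      refine le_trans ?_ (Complex.abs_re_le_norm _)
      simpa using (by linarith : 1 ≤ w.re + 1).trans (le_abs_self _)
    have h3 : ‖w‖ ≤ ‖w + (1 + Complex.I)‖ := by
      refine (pow_le_pow_iff_left₀ (norm_nonneg _) (norm_nonneg _) two_ne_zero).1 ?_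
      rw [Complex.sq_norm, Complex.sq_norm, Complex.normSq_apply, Complex.normSq_apply]
      simp only [Complex.add_re, Complex.add_im, Complex.one_re, Complex.one_im, Complex.I_re,
        Complex.I_im]
      nlinarith
    linarith
  rcases hz0.eq_or_lt with hz | hz
  · refine (hgrow z).trans ?_
    rw [← hz]
    have : 1 + |z.im| ≤ 4 * (1 + ‖z‖) := by linarith [Complex.abs_im_le_norm z, norm_nonneg z]
    calc _ = C * (1 + |z.im|) ^ N := by simp
      _ ≤ C * (4 * (1 + ‖z‖)) ^ N := by gcongr
      _ = _ := by rw [mul_pow]; ring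
  have hzne : z ≠ 0 := fun h => by simp [h] at hz
  have harg0 : 0 ≤ z.arg := Complex.arg_nonneg_iff.2 hz1
  have harg : z.arg < Real.pi / 2 :=
    (abs_lt.1 (Complex.abs_arg_lt_pi_div_two_iff.2 (Or.inl hz))).2
  -- The quadrant is exactly the critical opening for order two, so work in a smaller sector
  -- containing z and let θ tend to π/2 at the end.
  have key : ∀ θ, z.arg ≤ θ → 0 < θ → θ < Real.pi / 2 →
      ‖H z‖ * Real.exp (-(2 * (a * Real.cos θ / (2 * Real.sin θ)) * z.re * z.im))
        ≤ C * 4 ^ N * (1 + ‖z‖) ^ N := by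
    intro θ hzθ hθ0 hθ
    have hsin : 0 < Real.sin θ := Real.sin_pos_of_pos_of_lt_pi hθ0 (by linarith)
    have hcos : 0 < Real.cos θ := Real.cos_pos_of_mem_Ioo ⟨by linarith, hθ⟩
    -- With this δ the factor e^{iδw²}, of modulus e^{-2δ Re w Im w}, cancels e^{a (Re w)²} exactly
    -- on the ray arg w = θ. It has modulus 1 on the real axis and at most 1 in the quadrant.
    set δ := a * Real.cos θ / (2 * Real.sin θ) with hδ
    have hδ0 : 0 ≤ δ := by positivity
    have hpos : ∀ w : ℂ, 0 ≤ w.re → 0 ≤ w.im → 0 < ‖w + (1 + Complex.I)‖ := fun w h0 h1 => by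
      linarith [hlow w h0 h1, norm_nonneg w]
    have hnorm : ∀ w, ‖H w * Complex.exp (Complex.I * δ * w ^ 2) / (w + (1 + Complex.I)) ^ N‖
        = ‖H w‖ * Real.exp (-(2 * δ * w.re * w.im)) / ‖w + (1 + Complex.I)‖ ^ N := fun w => by
      rw [norm_div, norm_mul, norm_cexp_I_mul_sq, norm_pow]
    have hstep : ∀ w : ℂ, 0 ≤ w.re → 0 ≤ w.im → ∀ E : ℝ, 0 ≤ E →
        ‖H w‖ * Real.exp (-(2 * δ * w.re * w.im)) ≤ C * (1 + ‖w‖) ^ N * E →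
        ‖H w * Complex.exp (Complex.I * δ * w ^ 2) / (w + (1 + Complex.I)) ^ N‖
          ≤ C * 2 ^ N * E := by
      intro w h0 h1 E hE h
      rw [hnorm, div_le_iff₀ (pow_pos (hpos w h0 h1) N)]
      refine h.trans ?_
      calc C * (1 + ‖w‖) ^ N * E ≤ C * (2 * ‖w + (1 + Complex.I)‖) ^ N * E := by
            gcongr
            exact hlow w h0 h1
        _ = _ := by rw [mul_pow]; ring
    have him : ∀ w : ℂ, (1 + |w.im|) ^ N ≤ (1 + ‖w‖) ^ N := fun w => by
      gcongr
      exact Complex.abs_im_le_norm w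
    have hPL := PhragmenLindelof.norm_le_of_sector
      (f := fun w => H w * Complex.exp (Complex.I * δ * w ^ 2) / (w + (1 + Complex.I)) ^ N)
      (A := C * 2 ^ N) (B := a) (C := C * 2 ^ N) hθ hθ0 ?_ ?_ ?_ ?_ hzne harg0 hzθ
    · rw [hnorm, div_le_iff₀ (pow_pos (hpos z hz0 hz1) N)] at hPL
      refine hPL.trans ?_
      have h2 : ‖z + (1 + Complex.I)‖ ≤ 2 * (1 + ‖z‖) := by
        have h3 := norm_add_le z (1 + Complex.I)
        have h4 := norm_add_le (1 : ℂ) Complex.I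
        rw [norm_one, Complex.norm_I] at h4
        linarith [norm_nonneg z]
      calc C * 2 ^ N * ‖z + (1 + Complex.I)‖ ^ N ≤ C * 2 ^ N * (2 * (1 + ‖z‖)) ^ N := by gcongr
        _ = _ := by
          rw [mul_pow, show (4 : ℝ) = 2 * 2 by norm_num, mul_pow]
          ring
    · intro w h0 h1
      have : (w + (1 + Complex.I)) ^ N ≠ 0 := pow_ne_zero _ (norm_pos_iff.1 (hpos w h0 h1))
      have := hH w
      fun_prop (disch := assumption)
    · intro w h0 h1
      refine hstep w h0 h1 _ (Real.exp_pos _).le ?_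
      refine (mul_le_of_le_one_right (norm_nonneg _) ?_).trans ((hgrow w).trans ?_)
      · rw [Real.exp_le_one_iff]
        have : 0 ≤ 2 * δ * w.re * w.im := by positivity
        linarith
      · have h2 : w.re ^ 2 ≤ ‖w‖ ^ 2 := by
          rw [← sq_abs w.re]
          gcongr
          exact Complex.abs_re_le_norm w
        gcongr ?_ * ?_
        · gcongr ?_ * ?_
          exact him w
        · gcongr
    · intro r hr
      have := hstep r (by simpa using hr.le) (by simp) 1 zero_le_one (by
        simpa using hre r)
      simpa using this
    · intro r hr
      set w : ℂ := r * Complex.exp (θ * Complex.I) with hw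
      have hwre : w.re = r * Real.cos θ := by
        rw [hw, Complex.re_ofReal_mul, Complex.exp_ofReal_mul_I_re]
      have hwim : w.im = r * Real.sin θ := by
        rw [hw, Complex.im_ofReal_mul, Complex.exp_ofReal_mul_I_im]
      have := hstep w (by rw [hwre]; positivity) (by rw [hwim]; positivity) 1 zero_le_one (by
        rw [mul_one]
        have hcancel : a * w.re ^ 2 + -(2 * δ * w.re * w.im) = 0 := by
          rw [hwre, hwim, hδ]
          field_simp
          ring
        calc _ ≤ C * (1 + |w.im|) ^ N * Real.exp (a * w.re ^ 2)
              * Real.exp (-(2 * δ * w.re * w.im)) := by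
              gcongr
              exact hgrow w
          _ = C * (1 + |w.im|) ^ N := by
            rw [mul_assoc, ← Real.exp_add, hcancel, Real.exp_zero, mul_one]
          _ ≤ _ := by
            gcongr ?_ * ?_
            exact him w)
      simpa using this
  -- As θ → π/2, δ → 0 and the auxiliary factor disappears, while the bound does not depend on θ.
  have hlim : Tendsto (fun θ : ℝ =>
      ‖H z‖ * Real.exp (-(2 * (a * Real.cos θ / (2 * Real.sin θ)) * z.re * z.im)))
      (𝓝[<] (Real.pi / 2)) (𝓝 ‖H z‖) := by
    have : ContinuousAt (fun θ : ℝ =>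
      ‖H z‖ * Real.exp (-(2 * (a * Real.cos θ / (2 * Real.sin θ)) * z.re * z.im)))
      (Real.pi / 2) := by
      have : 2 * Real.sin (Real.pi / 2) ≠ 0 := by simp
      fun_prop (disch := assumption)
    have h := this.tendsto.mono_left (nhdsWithin_le_nhds (s := Set.Iio (Real.pi / 2)))
    simpa using h
  refine le_of_tendsto hlim ?_
  filter_upwards [Ioo_mem_nhdsLT harg] with θ hθ
  exact key θ hθ.1.le (harg0.trans_lt hθ.1) hθ.2

/-- The hypotheses are invariant under conjugation and under z ↦ -z, which carry the other quadrants
to the first. -/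
lemma norm_le_of_real_axis_of_order_two {H : ℂ → ℂ} (hH : Differentiable ℂ H) {a C : ℝ} {N : ℕ}
    (ha : 0 ≤ a)
    (hgrow : ∀ z, ‖H z‖ ≤ C * (1 + |z.im|) ^ N * Real.exp (a * z.re ^ 2))
    (hre : ∀ x : ℝ, ‖H x‖ ≤ C * (1 + |x|) ^ N) (z : ℂ) :
    ‖H z‖ ≤ C * 4 ^ N * (1 + ‖z‖) ^ N := by
  have hupper : ∀ {K : ℂ → ℂ}, Differentiable ℂ K →
      (∀ z, ‖K z‖ ≤ C * (1 + |z.im|) ^ N * Real.exp (a * z.re ^ 2)) →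
      (∀ x : ℝ, ‖K x‖ ≤ C * (1 + |x|) ^ N) → ∀ z : ℂ, 0 ≤ z.re →
      ‖K z‖ ≤ C * 4 ^ N * (1 + ‖z‖) ^ N := by
    intro K hK hKg hKr z hz
    rcases le_total 0 z.im with h | h
    · exact norm_le_of_first_quadrant hK ha hKg hKr hz h
    · have := norm_le_of_first_quadrant (H := conj ∘ K ∘ conj) 
        (fun w => by simpa using (hK (conj w)).conj_conj) ha
        (fun w => by simpa using hKg (conj w)) (fun x => by simpa using hKr x)
        (z := conj z) (by simpa using hz) (by simpa using h)
      simpa using this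
  rcases le_total 0 z.re with h | h
  · exact hupper hH hgrow hre z h
  · have := hupper (K := fun w => H (-w)) (hH.comp differentiable_neg)
      (fun w => by simpa using hgrow (-w)) (fun x => by simpa using hre (-x)) (-z) (by simpa using h)
    simpa using this

/-! ### Entire extension of the Fourier transform and Hardy's uncertainty principle -/

/-- Completing the square, half of the Gaussian absorbs the exponential. This supplies the
dominating functions for differentiating the Fourier integral at complex frequencies. -/
lemma integrable_one_add_abs_pow_mul_exp_abs_mul_exp_neg_mul_sq (N : ℕ) {b : ℝ} (hb : 0 < b)
    (k : ℝ) :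
    Integrable fun x : ℝ => (1 + |x|) ^ N * Real.exp (k * |x|) * Real.exp (-(b * x ^ 2)) := by
  refine ((integrable_one_add_abs_pow_mul_exp_neg_mul_sq N (half_pos hb)).const_mul
    (Real.exp (k ^ 2 / (2 * b)))).mono' (by fun_prop) (ae_of_all _ fun x => ?_)
  rw [Real.norm_of_nonneg (by positivity), mul_assoc, ← Real.exp_add, mul_left_comm,
    ← Real.exp_add]
  refine mul_le_mul_of_nonneg_left (Real.exp_le_exp.2 ?_) (by positivity)
  have h : k ^ 2 / (2 * b) + -(b / 2 * x ^ 2) - (k * |x| + -(b * x ^ 2))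
      = (k - b * |x|) ^ 2 / (2 * b) := by
    field_simp
    rw [← sq_abs x]
    ring
  have : 0 ≤ (k - b * |x|) ^ 2 / (2 * b) := by positivity
  linarith

section GaussianDecay

variable {lam C : ℝ} {N : ℕ} {g : ℝ → ℂ}

lemma norm_cexp_neg_two_pi_I_mul (x : ℝ) (z : ℂ) :
    ‖Complex.exp (-2 * Real.pi * Complex.I * x * z)‖ = Real.exp (2 * Real.pi * x * z.im) := by
  rw [Complex.norm_exp]
  congr 1
  simp

lemma differentiable_integral_cexp_mul (hlam : 0 < lam) (hc : Continuous g)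
    (hg : ∀ x, ‖g x‖ ≤ C * ((1 + |x|) ^ N * Real.exp (-(lam * Real.pi * x ^ 2)))) :
    Differentiable ℂ fun z : ℂ => ∫ x : ℝ, Complex.exp (-2 * Real.pi * Complex.I * x * z) * g x := by
  have hC : 0 ≤ C := by simpa using (norm_nonneg _).trans (hg 0)
  have hb : 0 < lam * Real.pi := mul_pos hlam Real.pi_pos
  intro z₀
  have hexp : ∀ (z : ℂ) (x : ℝ), ‖z‖ ≤ ‖z₀‖ + 1 →
      ‖Complex.exp (-2 * Real.pi * Complex.I * x * z)‖
        ≤ Real.exp (2 * Real.pi * (‖z₀‖ + 1) * |x|) := by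
    intro z x hz
    rw [norm_cexp_neg_two_pi_I_mul, Real.exp_le_exp]
    have : x * z.im ≤ |x| * (‖z₀‖ + 1) := by
      refine (le_abs_self _).trans ?_
      rw [abs_mul]
      gcongr
      exact (Complex.abs_im_le_norm z).trans hz
    nlinarith [Real.pi_pos]
  have hnear : ∀ z ∈ Metric.ball z₀ 1, ‖z‖ ≤ ‖z₀‖ + 1 := by
    intro z hz
    have := norm_le_norm_add_norm_sub' z z₀
    rw [Metric.mem_ball, dist_eq_norm] at hz
    linarith
  have h := hasDerivAt_integral_of_dominated_loc_of_deriv_le (μ := volume) (x₀ := z₀)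
    (s := Metric.ball z₀ 1)
    (F := fun z (x : ℝ) => Complex.exp (-2 * Real.pi * Complex.I * x * z) * g x)
    (F' := fun z (x : ℝ) => Complex.exp (-2 * Real.pi * Complex.I * x * z)
      * (-2 * Real.pi * Complex.I * x) * g x)
    -- The exponent N + 1 accounts for the factor x produced by differentiating in z.
    (bound := fun x => 2 * Real.pi * C * ((1 + |x|) ^ (N + 1)
      * Real.exp (2 * Real.pi * (‖z₀‖ + 1) * |x|) * Real.exp (-(lam * Real.pi * x ^ 2))))
    (Metric.ball_mem_nhds _ one_pos)
    (Eventually.of_forall fun z => Continuous.aestronglyMeasurable (by fun_prop)) ?_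
    (Continuous.aestronglyMeasurable (by fun_prop)) (ae_of_all _ fun x z hz => ?_)
    ((integrable_one_add_abs_pow_mul_exp_abs_mul_exp_neg_mul_sq _ hb _).const_mul _)
    (ae_of_all _ fun x z _ => ?_)
  · exact h.2.differentiableAt
  · refine ((integrable_one_add_abs_pow_mul_exp_abs_mul_exp_neg_mul_sq N hb
      (2 * Real.pi * (‖z₀‖ + 1))).const_mul C).mono'
      (Continuous.aestronglyMeasurable (by fun_prop)) (ae_of_all _ fun x => ?_)
    rw [norm_mul]
    calc _ ≤ Real.exp (2 * Real.pi * (‖z₀‖ + 1) * |x|)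
          * (C * ((1 + |x|) ^ N * Real.exp (-(lam * Real.pi * x ^ 2)))) := by
          gcongr
          · exact hexp z₀ x (by linarith)
          · exact hg x
      _ = _ := by ring
  · have hx : ‖(-2 * Real.pi * Complex.I * x : ℂ)‖ ≤ 2 * Real.pi * (1 + |x|) := by
      simp only [norm_mul, norm_neg, Complex.norm_real, Complex.norm_I, Complex.norm_ofNat,
        Real.norm_eq_abs, abs_of_pos Real.pi_pos, mul_one]
      gcongr
      linarith
    simp only [norm_mul (_ * _) (g x), norm_mul (Complex.exp _)]
    calc _ ≤ Real.exp (2 * Real.pi * (‖z₀‖ + 1) * |x|) * (2 * Real.pi * (1 + |x|))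
          * (C * ((1 + |x|) ^ N * Real.exp (-(lam * Real.pi * x ^ 2)))) := by
          gcongr
          · exact hexp z x (hnear z hz)
          · exact hg x
      _ = _ := by ring
  · refine HasDerivAt.mul_const ?_ _
    have := ((hasDerivAt_id z).const_mul (-2 * Real.pi * Complex.I * x)).cexp
    simpa using this

/-- With y = Im z, completing the square in 2πxy - λπx² leaves e^{πy²/λ} times a Gaussian centred at
y/λ. Recentring the polynomial weight costs (1 + 1/λ)^N (1 + |y|)^N, and the remaining integral is
translation invariant. -/
lemma exists_norm_integral_cexp_mul_le (hlam : 0 < lam)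
    (hg : ∀ x, ‖g x‖ ≤ C * ((1 + |x|) ^ N * Real.exp (-(lam * Real.pi * x ^ 2)))) :
    ∃ K : ℝ, ∀ z : ℂ, ‖∫ x : ℝ, Complex.exp (-2 * Real.pi * Complex.I * x * z) * g x‖
      ≤ K * (1 + |z.im|) ^ N * Real.exp (lam⁻¹ * Real.pi * z.im ^ 2) := by
  have hC : 0 ≤ C := by simpa using (norm_nonneg _).trans (hg 0)
  have hb : 0 < lam * Real.pi := mul_pos hlam Real.pi_pos
  set φ : ℝ → ℝ := fun x => (1 + |x|) ^ N * Real.exp (-(lam * Real.pi * x ^ 2)) with hφ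
  have hφi : Integrable φ := integrable_one_add_abs_pow_mul_exp_neg_mul_sq N hb
  refine ⟨C * (1 + lam⁻¹) ^ N * ∫ x, φ x, fun z => ?_⟩
  have hpt : ∀ x : ℝ, ‖Complex.exp (-2 * Real.pi * Complex.I * x * z) * g x‖
      ≤ (C * (1 + lam⁻¹) ^ N * (1 + |z.im|) ^ N * Real.exp (lam⁻¹ * Real.pi * z.im ^ 2))
        * φ (x - lam⁻¹ * z.im) := by
    intro x
    rw [norm_mul, norm_cexp_neg_two_pi_I_mul]
    have h1 : (1 + |x|) ≤ (1 + lam⁻¹) * (1 + |z.im|) * (1 + |x - lam⁻¹ * z.im|) := by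
      have h2 : |x| ≤ |x - lam⁻¹ * z.im| + lam⁻¹ * |z.im| := by
        have := abs_add_le (x - lam⁻¹ * z.im) (lam⁻¹ * z.im)
        rwa [sub_add_cancel, abs_mul, abs_of_pos (inv_pos.2 hlam)] at this
      have h3 : 0 ≤ lam⁻¹ := (inv_pos.2 hlam).le
      have h4 : 0 ≤ lam⁻¹ * |z.im| := by positivity
      have h5 : 0 ≤ (lam⁻¹ + |z.im| + lam⁻¹ * |z.im|) * |x - lam⁻¹ * z.im| := by positivity
      nlinarith [abs_nonneg z.im]
    have h6 : Real.exp (2 * Real.pi * x * z.im) * Real.exp (-(lam * Real.pi * x ^ 2))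
        = Real.exp (lam⁻¹ * Real.pi * z.im ^ 2)
          * Real.exp (-(lam * Real.pi * (x - lam⁻¹ * z.im) ^ 2)) := by
      rw [← Real.exp_add, ← Real.exp_add]
      congr 1
      field_simp
      ring
    calc _ ≤ Real.exp (2 * Real.pi * x * z.im)
          * (C * ((1 + |x|) ^ N * Real.exp (-(lam * Real.pi * x ^ 2)))) := by
          gcongr
          exact hg x
      _ = C * (1 + |x|) ^ N
          * (Real.exp (2 * Real.pi * x * z.im) * Real.exp (-(lam * Real.pi * x ^ 2))) := by ring
      _ ≤ C * ((1 + lam⁻¹) * (1 + |z.im|) * (1 + |x - lam⁻¹ * z.im|)) ^ N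
          * (Real.exp (2 * Real.pi * x * z.im) * Real.exp (-(lam * Real.pi * x ^ 2))) := by
          gcongr
      _ = _ := by
          rw [h6, mul_pow, mul_pow, hφ]
          ring
  refine (norm_integral_le_of_norm_le ((hφi.comp_sub_right _).const_mul _)
    (ae_of_all _ hpt)).trans_eq ?_
  rw [integral_const_mul, integral_sub_right_eq_self φ]
  ring

/-- **Hardy's uncertainty principle**, in the critical case and with polynomial factors. -/
theorem exists_eq_hermiteFun_of_norm_le (hlam : 0 < lam) (hc : Continuous g)
    (hg : ∀ x, ‖g x‖ ≤ C * ((1 + |x|) ^ N * Real.exp (-(lam * Real.pi * x ^ 2)))) {D : ℝ}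
    (hF : ∀ ξ, ‖𝓕 g ξ‖ ≤ D * ((1 + |ξ|) ^ N * Real.exp (-(lam⁻¹ * Real.pi * ξ ^ 2)))) :
    ∃ Q : Polynomial ℂ, Q.natDegree ≤ N ∧ g = hermiteFun lam Q := by
  set G : ℂ → ℂ := fun z => ∫ x : ℝ, Complex.exp (-2 * Real.pi * Complex.I * x * z) * g x with hG
  have hGd : Differentiable ℂ G := differentiable_integral_cexp_mul hlam hc hg
  obtain ⟨K, hK⟩ := exists_norm_integral_cexp_mul_le hlam hg
  have hGF : ∀ ξ : ℝ, G ξ = 𝓕 g ξ := fun ξ => by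
    rw [Real.fourier_real_eq_integral_exp_smul]
    refine integral_congr_ae (ae_of_all _ fun x => ?_)
    simp only [smul_eq_mul]
    congr 2
    push_cast
    ring
  set a : ℝ := lam⁻¹ * Real.pi with ha
  have ha0 : 0 < a := by positivity
  -- This factor cancels the decay of the transform on the real axis and the growth of G on the
  -- imaginary axis, so H is polynomially bounded on both.
  set H : ℂ → ℂ := fun z => G z * Complex.exp (a * z ^ 2) with hH
  have hHd : Differentiable ℂ H := by fun_prop
  have hHg : ∀ z, ‖H z‖ ≤ max K D * (1 + |z.im|) ^ N * Real.exp (a * z.re ^ 2) := by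
    intro z
    rw [hH, norm_mul, norm_cexp_mul_sq]
    calc _ ≤ K * (1 + |z.im|) ^ N * Real.exp (a * z.im ^ 2)
          * Real.exp (a * (z.re ^ 2 - z.im ^ 2)) := by
          gcongr
          exact hK z
      _ = K * (1 + |z.im|) ^ N * Real.exp (a * z.re ^ 2) := by
          rw [mul_assoc, ← Real.exp_add]
          ring_nf
      _ ≤ _ := by
          gcongr
          exact le_max_left _ _
  have hHr : ∀ x : ℝ, ‖H x‖ ≤ max K D * (1 + |x|) ^ N := by
    intro x
    rw [hH, norm_mul, norm_cexp_mul_sq, hGF]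
    calc _ ≤ D * ((1 + |x|) ^ N * Real.exp (-(a * x ^ 2)))
          * Real.exp (a * ((x : ℂ).re ^ 2 - (x : ℂ).im ^ 2)) := by
          gcongr
          exact hF x
      _ = D * (1 + |x|) ^ N := by
          rw [mul_assoc, mul_assoc, ← Real.exp_add]
          simp
      _ ≤ _ := by
          gcongr
          exact le_max_right _ _
  obtain ⟨P, hP, hPe⟩ := hHd.exists_polynomial_of_norm_le
    (norm_le_of_real_axis_of_order_two hHd ha0.le hHg hHr)
  have hFP : 𝓕 g = hermiteFun lam⁻¹ P := by
    ext ξ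
    rw [hermiteFun, ← hPe, hH, ← hGF]
    simp only
    rw [mul_assoc, Complex.ofReal_exp, ← Complex.exp_add, ha]
    push_cast
    rw [add_neg_cancel, Complex.exp_zero, mul_one]
  have hgi : Integrable g :=
    ((integrable_one_add_abs_pow_mul_exp_neg_mul_sq N (mul_pos hlam Real.pi_pos)).const_mul
      C).mono' hc.aestronglyMeasurable (ae_of_all _ hg)
  have hinv := hc.fourierInv_fourier_eq hgi
    (by rw [hFP]; exact integrable_hermiteFun (inv_pos.2 hlam) P)
  obtain ⟨Q, hQ, hQF⟩ := exists_fourier_hermiteFun (inv_pos.2 hlam) hP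
  -- The inverse transform is the transform evaluated at -x, hence the reflected polynomial.
  refine ⟨Q.comp (-Polynomial.X), ?_, ?_⟩
  · refine Polynomial.natDegree_comp_le.trans ?_
    simpa using hQ
  · rw [← hinv]
    ext x
    rw [Real.fourierInv_eq_fourier_neg, hFP, hQF, inv_inv]
    simp [hermiteFun]

end GaussianDecay

/-! ### The cone Ω⁺, the Gaussian and the interval of a Hermite function -/

lemma IsPosDefFun.ofReal_mul {E : Type*} [AddGroup E] {f : E → ℂ} (hf : IsPosDefFun f) {t : ℝ}
    (ht : 0 ≤ t) : IsPosDefFun fun x => (t : ℂ) * f x := by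
  intro n x c
  have h := mul_nonneg (Complex.zero_le_real.2 ht) (hf n x c)
  rw [Finset.mul_sum] at h
  simp only [Finset.mul_sum] at h
  refine h.trans_eq (Finset.sum_congr rfl fun j _ => Finset.sum_congr rfl fun k _ => ?_)
  ring

/-- The points x, 0 with coefficients 1, -1 give f(x) + f(-x) ≤ 2 f(0), and f(-x) ≥ 0 may be
dropped. Only boundedness matters later, so the factor 2 is harmless. -/
lemma IsPosDefFun.norm_le_of_nonneg {E : Type*} [AddGroup E] {f : E → ℂ} (hf : IsPosDefFun f)
    (h0 : ∀ x, 0 ≤ f x) (x : E) : ‖f x‖ ≤ ‖2 * f 0‖ := by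
  have h := hf 2 ![x, 0] ![1, -1]
  simp only [Fin.sum_univ_two, Matrix.cons_val_zero, Matrix.cons_val_one, map_one, map_neg,
    sub_self, sub_zero, zero_sub] at h
  refine CStarAlgebra.norm_le_norm_of_nonneg_of_le (h0 x) ?_
  have h2 := add_nonneg h (h0 (-x))
  rw [← sub_nonneg]
  refine h2.trans_eq ?_
  ring

lemma OmegaPlus.ofReal_mul {E : Type*} [NormedAddCommGroup E] {f : E → ℂ} (hf : f ∈ OmegaPlus E)
    {t : ℝ} (ht : 0 ≤ t) : (fun x => (t : ℂ) * f x) ∈ OmegaPlus E := by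
  obtain ⟨⟨hc, hr, hp⟩, h0⟩ := hf
  exact ⟨⟨by fun_prop, fun x y hxy => by simp only [hr x y hxy], hp.ofReal_mul ht⟩,
    fun x => mul_nonneg (Complex.zero_le_real.2 ht) (h0 x)⟩

/-- The easy half of Bochner's theorem: the quadratic form is the integral of |∑ c_j e^{i x_j s}|².
-/
lemma isPosDefFun_charFun (μ : Measure ℝ) [IsFiniteMeasure μ] : IsPosDefFun (charFun μ) := by
  intro n x c
  have hexp : ∀ (t s : ℝ), ‖Complex.exp (t * s * Complex.I)‖ ≤ 1 := fun t s => by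
    rw [← Complex.ofReal_mul, Complex.norm_exp_ofReal_mul_I]
  have hint : ∀ (a : ℂ) (t : ℝ), Integrable (fun s : ℝ => a * Complex.exp (t * s * Complex.I)) μ :=
    fun a t => (Integrable.of_bound (Continuous.aestronglyMeasurable (by fun_prop)) 1
      (ae_of_all _ (hexp t))).const_mul a
  have h : ∑ j, ∑ k, c j * conj (c k) * charFun μ (x j - x k)
      = ∫ s, ((‖∑ j, c j * Complex.exp (x j * s * Complex.I)‖ ^ 2 : ℝ) : ℂ) ∂μ := by
    simp only [charFun_apply_real, ← integral_const_mul]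
    simp only [← integral_finsetSum _ fun k _ => hint _ _]
    rw [← integral_finsetSum _ fun j _ => integrable_finsetSum _ fun k _ => hint _ _]
    refine integral_congr_ae (ae_of_all _ fun s => ?_)
    simp only
    rw [Complex.ofReal_pow, ← Complex.mul_conj', map_sum, Finset.sum_mul_sum]
    refine Finset.sum_congr rfl fun j _ => Finset.sum_congr rfl fun k _ => ?_
    have h1 : Complex.exp ((x j - x k : ℝ) * s * Complex.I)
        = Complex.exp (x j * s * Complex.I) * conj (Complex.exp (x k * s * Complex.I)) := by
      rw [← Complex.exp_conj, ← Complex.exp_add]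
      congr 1
      simp only [map_mul, Complex.conj_ofReal, Complex.conj_I, Complex.ofReal_sub]
      ring
    rw [h1, map_mul]
    ring
  rw [h, integral_complex_ofReal]
  exact Complex.zero_le_real.2 (integral_nonneg fun s => by positivity)

lemma gaussian_mem_omegaPlus {lam : ℝ} (hlam : 0 < lam) :
    (fun x : ℝ => (Real.exp (-(lam * Real.pi * x ^ 2)) : ℂ)) ∈ OmegaPlus ℝ := by
  refine ⟨⟨by fun_prop, fun x y hxy => ?_, ?_⟩, fun x => Complex.zero_le_real.2 (Real.exp_pos _).le⟩
  · have : x ^ 2 = y ^ 2 := sq_eq_sq_iff_abs_eq_abs x y |>.2 hxy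
    simp only [this]
  -- Variance v gives the characteristic function e^{-v x²/2}, so v = 2λπ.
  · have h := isPosDefFun_charFun (gaussianReal 0 (2 * lam * Real.pi).toNNReal)
    have heq : charFun (gaussianReal 0 (2 * lam * Real.pi).toNNReal)
        = fun x : ℝ => (Real.exp (-(lam * Real.pi * x ^ 2)) : ℂ) := by
      ext x
      rw [charFun_gaussianReal, Real.coe_toNNReal _ (by positivity)]
      push_cast
      congr 1
      ring
    rwa [heq] at h

/-- Both g and its transform are dominated by those of the Hermite function, because the
complementary summand h and its transform are nonnegative; Hardy's principle then applies. -/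
lemma omegaInterval_hermiteFun_subset {lam : ℝ} (hlam : 0 < lam) {N : ℕ} {P : Polynomial ℂ}
    (hP : P.natDegree ≤ N) :
    OmegaInterval (hermiteFun lam P) ⊆
      {g | ∃ Q : Polynomial ℂ, Q.natDegree ≤ N ∧ g = hermiteFun lam Q} := by
  rintro g ⟨⟨⟨hgc, -, hgp⟩, hg0⟩, h, ⟨⟨hhc, -, hhp⟩, hh0⟩, hgh⟩
  have hsum : hermiteFun lam P = g + h := by rw [hgh, sub_add_cancel]
  have hle : ∀ x, g x ≤ hermiteFun lam P x ∧ h x ≤ hermiteFun lam P x := fun x => by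
    rw [hsum]
    exact ⟨le_add_of_nonneg_right (hh0 x), le_add_of_nonneg_left (hg0 x)⟩
  obtain ⟨C, hC, hPC⟩ := exists_norm_hermiteFun_le lam hP
  obtain ⟨R, hR, hRF⟩ := exists_fourier_hermiteFun hlam hP
  obtain ⟨D, hD, hRD⟩ := exists_norm_hermiteFun_le lam⁻¹ hR
  have hnorm : ∀ {u v : ℂ}, 0 ≤ u → u ≤ v → ‖u‖ ≤ ‖v‖ := fun h0 h1 =>
    CStarAlgebra.norm_le_norm_of_nonneg_of_le h0 h1
  have hgn : ∀ x, ‖g x‖ ≤ ‖hermiteFun lam P x‖ := fun x => hnorm (hg0 x) (hle x).1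
  have hhn : ∀ x, ‖h x‖ ≤ ‖hermiteFun lam P x‖ := fun x => hnorm (hh0 x) (hle x).2
  have hPi := integrable_hermiteFun hlam P
  have hgi : Integrable g := hPi.mono hgc.aestronglyMeasurable (ae_of_all _ hgn)
  have hhi : Integrable h := hPi.mono hhc.aestronglyMeasurable (ae_of_all _ hhn)
  have hFg := hgp.fourier_nonneg hgc (hgp.norm_le_of_nonneg hg0) hgi
  have hFh := hhp.fourier_nonneg hhc (hhp.norm_le_of_nonneg hh0) hhi
  have hF : 𝓕 (hermiteFun lam P) = 𝓕 g + 𝓕 h := by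
    rw [hsum]
    exact VectorFourier.fourierIntegral_add Real.continuous_fourierChar (by fun_prop) hgi hhi
  refine exists_eq_hermiteFun_of_norm_le hlam hgc (fun x => (hgn x).trans (hPC x)) (D := D)
    fun ξ => le_trans (hnorm (hFg ξ) ?_) (hRD ξ)
  rw [← hRF, hF]
  exact le_add_of_nonneg_right (hFh ξ)

end

theorem mainTheorem4 (lam : ℝ) (hlam : 0 < lam) :
    (∀ (N : ℕ) (P : Polynomial ℂ), P.natDegree = N → hermiteFun lam P ∈ OmegaPlus ℝ →
      OmegaInterval (hermiteFun lam P) ⊆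
        {g | ∃ Q : Polynomial ℂ, Q.natDegree ≤ N ∧ g = hermiteFun lam Q}) ∧
    IsExtremalRayGenerator (fun x : ℝ => (Real.exp (-(lam * Real.pi * x ^ 2)) : ℂ)) := by
  refine ⟨fun N P hP _ => omegaInterval_hermiteFun_subset hlam hP.le,
    gaussian_mem_omegaPlus hlam, Set.Subset.antisymm ?_ ?_⟩
  · intro g hg
    have h1 : hermiteFun lam 1 = fun x : ℝ => (Real.exp (-(lam * Real.pi * x ^ 2)) : ℂ) := by
      ext x
      simp [hermiteFun]
    obtain ⟨Q, hQ, hgQ⟩ := omegaInterval_hermiteFun_subset hlam (N := 0) (P := 1)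
      (by simp) (by rwa [h1])
    obtain ⟨⟨-, hg0⟩, h, ⟨-, hh0⟩, hgh⟩ := hg
    obtain ⟨t, ht⟩ : ∃ t : ℂ, g = fun x : ℝ => t * (Real.exp (-(lam * Real.pi * x ^ 2)) : ℂ) :=
      ⟨Q.coeff 0, by
        rw [hgQ, Polynomial.eq_C_of_natDegree_le_zero hQ]
        ext x
        simp [hermiteFun]⟩
    -- At the origin the Gaussian equals 1, so t = g(0) = 1 - h(0). The order on ℂ also forces t to
    -- be real.
    have ht0 : 0 ≤ t := by simpa [ht] using hg0 0
    have ht1 : t ≤ 1 := by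
      have h2 := congrFun hgh 0
      have h3 : t = 1 - h 0 := by simpa [ht] using h2
      rw [h3]
      exact sub_le_self _ (hh0 0)
    have htr : ((t.re : ℝ) : ℂ) = t := (Complex.eq_re_of_ofReal_le (r := 0) (by simpa using ht0)).symm
    exact ⟨t.re, (Complex.le_def.1 ht0).1, (Complex.le_def.1 ht1).1, by rw [htr]; exact ht⟩
  · rintro _ ⟨t, ht0, ht1, rfl⟩
    -- The complementary summand is (1 - t) times the Gaussian.
    refine ⟨OmegaPlus.ofReal_mul (gaussian_mem_omegaPlus hlam) ht0, _,
      OmegaPlus.ofReal_mul (gaussian_mem_omegaPlus hlam) (sub_nonneg.2 ht1), ?_⟩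
    ext x
    simp only [Pi.sub_apply]
    push_cast
    ring
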